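/- A sequence $\sigma$ is called a supersequence over a finite set $A$ (whose elements are called letters) if all elements of $\sigma$ belong to $A$ and every permutation of $A$, i.e. every sequence in which each letter of $A$ occurs exactly once and nothing else occurs, is a subsequence of $\sigma$ (obtained from $\sigma$ by deleting some or no elements and keeping the order of the rest). Theorem 24. For every real number $\epsilon > 0$ there exists a real constant $C_\epsilon$, depending only on $\epsilon$, and an integer $M$ such that for every integer $m \ge M$ and every set $A$ of $m$ letters there is a supersequence over $A$ of length exactly $\left\lceil m^2 - \left(\tfrac{5}{2} - \epsilon\right) m + C_\epsilon \right\rceil$. -/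

import Mathlib

/-- `ρ` is a permutation of the finite set `A`: a sequence listing every letter of `A` exactly once
(and no other letters). -/
def IsPermutationOf {α : Type*} (A : Finset α) (ρ : List α) : Prop :=
  ρ.Nodup ∧ ∀ a, a ∈ ρ ↔ a ∈ A

/-- `σ` is a supersequence over the finite set `A`: all elements of `σ` are letters of `A`, and
every permutation of `A` is a subsequence of `σ` (obtained by deleting elements of `σ`). -/
def IsSupersequenceOver {α : Type*} (A : Finset α) (σ : List α) : Prop :=
  (∀ a ∈ σ, a ∈ A) ∧ ∀ ρ : List α, IsPermutationOf A ρ → ρ.Sublist σ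

/-!
Three letters are special, the other `t = m - 3` are ordinary. The word runs cyclically through the
ordinary letters and is cut into blocks of `t - 1` of them. An ordinary letter that follows an
ordinary letter is found within the next `t - 1` ordinary positions, since the letter that recurs
only after `t` positions is the one just used. So in the greedy embedding of a permutation each
ordinary letter costs one block.

Special letters are inserted near the beginning of the blocks, at seven slots; which slot is filled
in a block depends on the parity of its index. If a special letter is requested while it is still
ahead in the current block, it costs nothing except that the offset within the block moves up to
that slot; the offset does not move back while no block is lost, and the spacing of the slots
absorbs the one extra step that an ordinary letter right after a special one may need. Otherwise
the letter is taken from the next block, and one block is lost. With the slots filled as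
in `slot`, the three special letters lose at most one block altogether, in whichever order and at
whichever parities they are requested: this is the finite check `exists_slot`, which feeds the
induction `Reaches.append`.

Hence `t + 1` blocks and a bounded remainder suffice. Two consecutive blocks hold seven special
letters, so the length is `(t + 1) * (t - 1 + 7 / 2) + O(1)`, which is `m ^ 2 - 5 / 2 * m + O(1)`.
This is below the required length, which is then reached by padding.
-/

/-! ### Slots for the special letters -/

/-- The seven slots of a block: slot `s` holds the special letter `(slot s).1`, but only in blocks
whose index has the parity `(slot s).2`. Even blocks read `0 1 2`, odd ones `1 0 2 1`. -/
def slot : Fin 7 → Fin 3 × Fin 2 :=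
  ![(1, 1), (0, 1), (0, 0), (1, 0), (2, 0), (2, 1), (1, 1)]

/-- If the special letters of `R` are still to come and `lost` blocks have been lost so far, then
every offset below `offsetCap R lost` allows at most one lost block in total, however the
remaining letters arrive. The value `0` marks the situations that never occur. -/
def offsetCap (R : Finset (Fin 3)) (lost : Fin 2) : ℕ :=
  if lost = 0 then
    if R = Finset.univ then 1
    else if R = {1, 2} then 5
    else if R = {0, 2} then 5
    else if R = {0, 1} then 7
    else 8
  else
    if R = {0} then 2
    else if R = {1} then 4
    else if R = {2} then 5
    else if R = ∅ then 8
    else 0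

theorem offsetCap_le (R : Finset (Fin 3)) (lost : Fin 2) : offsetCap R lost ≤ 8 := by
  unfold offsetCap; split_ifs <;> omega

/-- The finite heart of the argument: a requested special letter `c` is either still ahead in the
current block, or it is taken from the next block at the cost of one lost block, which happens at
most once. -/
theorem exists_slot : ∀ (R : Finset (Fin 3)) (lost : Fin 2) (a : Fin 8) (c : Fin 3) (e : Fin 2),
    c ∈ R → (a : ℕ) < offsetCap R lost →
    (∃ s : Fin 7, (a : ℕ) ≤ s ∧ slot s = (c, e) ∧ (s : ℕ) + 1 < offsetCap (R.erase c) lost) ∨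
    (lost = 0 ∧ ∃ s : Fin 7, slot s = (c, e + 1) ∧ (s : ℕ) + 1 < offsetCap (R.erase c) 1) := by
  decide

/-! ### The word -/

section Word

variable (t : ℕ)

/-- The special letters inserted after the ordinary letter at position `p`. Blocks consist of
`t - 1` ordinary letters, and slot `s` sits at offset `2 * s + 1` of its block. -/
def inserted (p : ℕ) : List (Fin 3) :=
  ((List.finRange 7).filter fun s : Fin 7 =>
    p % (t - 1) = 2 * (s : ℕ) + 1 ∧ p / (t - 1) % 2 = (slot s).2).map fun s => (slot s).1

variable {t}

theorem length_inserted (p : ℕ) : (inserted t p).length = ∑ s : Fin 7,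
    if p % (t - 1) = 2 * (s : ℕ) + 1 ∧ p / (t - 1) % 2 = (slot s).2 then 1 else 0 := by
  rw [inserted, List.length_map, Finset.sum_boole, ← List.toFinset_card_of_nodup
    ((List.nodup_finRange 7).filter _)]
  congr 1
  ext s
  simp

/-- Even blocks hold three special letters, odd blocks four. -/
theorem sum_length_inserted (ht : 15 ≤ t) (i : ℕ) :
    ∑ r ∈ Finset.range (t - 1), (inserted t (i * (t - 1) + r)).length = 3 + i % 2 := by
  have h : ∀ r ∈ Finset.range (t - 1), (inserted t (i * (t - 1) + r)).length =
      ∑ s : Fin 7, if r = 2 * (s : ℕ) + 1 then if i % 2 = (slot s).2 then 1 else 0 else 0 := by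
    intro r hr
    have hr := Finset.mem_range.1 hr
    rw [length_inserted, Nat.mul_add_mod', Nat.mod_eq_of_lt hr, mul_comm i,
      Nat.mul_add_div (by omega), Nat.div_eq_of_lt hr, add_zero]
    simp only [ite_and]
  rw [Finset.sum_congr rfl h, Finset.sum_comm]
  have h' : ∀ s : Fin 7, 2 * (s : ℕ) + 1 ∈ Finset.range (t - 1) := fun s =>
    Finset.mem_range.2 (by omega)
  simp only [Finset.sum_ite_eq', h', if_true]
  rcases Nat.mod_two_eq_zero_or_one i with hi | hi <;> rw [hi] <;> decide

variable (t) [NeZero t]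

/-- The `p`-th group of the word: an ordinary letter, the ordinary letters being run through
cyclically, followed by the special letters inserted there. -/
def group (p : ℕ) : List (Fin 3 ⊕ Fin t) :=
  Sum.inr (Fin.ofNat t p) :: (inserted t p).map Sum.inl

/-- The first `p` groups of the word. -/
def word (p : ℕ) : List (Fin 3 ⊕ Fin t) := (List.range p).flatMap (group t)

theorem word_succ (p : ℕ) : word t (p + 1) = word t p ++ group t p := by
  simp [word, List.range_succ]

theorem word_sublist {p p' : ℕ} (h : p ≤ p') : (word t p).Sublist (word t p') := by
  induction p', h using Nat.le_induction with
  | base => exact List.Sublist.refl _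
  | succ k _ ih => rw [word_succ]; exact ih.trans (List.sublist_append_left _ _)

variable {t}

/-! ### Greedy embedding -/

theorem append_sublist_word {l : List (Fin 3 ⊕ Fin t)} {p p' : ℕ} {b : Fin 3 ⊕ Fin t}
    (hl : l.Sublist (word t p)) (h : p ≤ p') (hb : b ∈ group t p') :
    (l ++ [b]).Sublist (word t (p' + 1)) := by
  rw [word_succ]
  exact (hl.trans (word_sublist t h)).append (List.singleton_sublist.2 hb)

theorem inr_mem_group {p : ℕ} {c : Fin t} (h : p % t = c) : Sum.inr c ∈ group t p := by
  have : Fin.ofNat t p = c := Fin.ext (by simpa using h)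
  rw [group, this]; exact List.mem_cons_self

theorem inl_mem_group (ht : 15 ≤ t) {i : ℕ} {s : Fin 7} {c : Fin 3}
    (h : ∀ e : Fin 2, (e : ℕ) = i % 2 → slot s = (c, e)) :
    Sum.inl c ∈ group t (i * (t - 1) + (2 * s + 1)) := by
  have hs := s.isLt
  have h1 : (i * (t - 1) + (2 * (s : ℕ) + 1)) % (t - 1) = 2 * s + 1 := by
    rw [Nat.mul_add_mod', Nat.mod_eq_of_lt (by omega)]
  have h2 : (i * (t - 1) + (2 * (s : ℕ) + 1)) / (t - 1) = i := by
    rw [mul_comm, Nat.mul_add_div (by omega), Nat.div_eq_of_lt (by omega), add_zero]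
  have h3 := h ⟨i % 2, Nat.mod_lt _ two_pos⟩ rfl
  simp only [group, List.mem_cons, reduceCtorEq, List.mem_map, Sum.inl.injEq, exists_eq_right,
    false_or, inserted, List.mem_map, List.mem_filter]
  exact ⟨s, ⟨List.mem_finRange s, by rw [h1, h2, h3]; simp⟩, by rw [h3]⟩

/-- `l` embeds into the part of the word before offset `a` of block `i`, where slot `s` counts as
lying at offset `s`. One more group is allowed when its ordinary letter already occurs in `l`, since
then the next ordinary letter is a different one. -/
def Reaches (l : List (Fin 3 ⊕ Fin t)) (i a : ℕ) : Prop :=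
  ∃ p, l.Sublist (word t p) ∧ (p ≤ i * (t - 1) + 2 * a ∨
    p ≤ i * (t - 1) + 2 * a + 1 ∧ ∃ c : Fin t, (c : ℕ) + 1 ≡ p [MOD t] ∧ Sum.inr c ∈ l)

theorem Reaches.inr {l : List (Fin 3 ⊕ Fin t)} {i a : ℕ} (h : Reaches l i a) {c : Fin t}
    (hc : Sum.inr c ∉ l) : Reaches (l ++ [Sum.inr c]) (i + 1) a := by
  obtain ⟨p, hl, hp⟩ := h
  have ht : 0 < t := Nat.pos_of_ne_zero (NeZero.ne t)
  -- the first occurrence of `c` from position `p` on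
  obtain ⟨p', h1, h2, h3⟩ : ∃ p', p ≤ p' ∧ p' < p + t ∧ p' % t = c := by
    have hc' := c.isLt
    have hd := Nat.div_add_mod p t
    have hm := Nat.mod_lt p ht
    rcases le_or_gt (p % t) c with hle | hlt
    · exact ⟨t * (p / t) + c, by omega, by omega,
        by rw [Nat.mul_add_mod, Nat.mod_eq_of_lt hc']⟩
    · exact ⟨t * (p / t + 1) + c, by rw [mul_add]; omega, by rw [mul_add]; omega,
        by rw [Nat.mul_add_mod, Nat.mod_eq_of_lt hc']⟩
  have hi : (i + 1) * (t - 1) = i * (t - 1) + (t - 1) := by ring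
  refine ⟨p' + 1, append_sublist_word hl h1 (inr_mem_group h3), Or.inr ⟨?_, c, ?_, by simp⟩⟩
  · rcases hp with hp | ⟨hp, d, hd, hdl⟩
    · omega
    · -- the last group before `p + t` holds `d`, which is already used
      have : p' + 1 ≠ p + t := by
        intro heq
        apply hc
        have h4 : (d : ℕ) ≡ p' [MOD t] := by
          apply Nat.ModEq.add_right_cancel' 1
          rw [heq]
          exact hd.trans (by simp [Nat.ModEq])
        have h5 : d = c := Fin.ext (by
          rw [← h3, ← Nat.mod_eq_of_lt d.isLt]; exact h4)
        rwa [← h5]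
      omega
  · exact Nat.ModEq.add_right 1 (by rw [Nat.ModEq, h3, Nat.mod_eq_of_lt c.isLt])

theorem Reaches.inl {l : List (Fin 3 ⊕ Fin t)} {i a : ℕ} (h : Reaches l i a) (ht : 15 ≤ t)
    {c : Fin 3} {s : Fin 7} (hc : ∀ e : Fin 2, (e : ℕ) = i % 2 → slot s = (c, e))
    (hs : a ≤ s) : Reaches (l ++ [Sum.inl c]) i (s + 1) := by
  obtain ⟨p, hl, hp⟩ := h
  exact ⟨_, append_sublist_word hl (by omega) (inl_mem_group ht hc), Or.inl (by omega)⟩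

theorem Reaches.next_block {l : List (Fin 3 ⊕ Fin t)} {i a : ℕ} (h : Reaches l i a) (ht : 15 ≤ t)
    (ha : a < 8) : Reaches l (i + 1) 0 := by
  obtain ⟨p, hl, hp⟩ := h
  have hi : (i + 1) * (t - 1) = i * (t - 1) + (t - 1) := by ring
  rcases hp with hp | ⟨hp, hc⟩
  · exact ⟨p, hl, Or.inl (by omega)⟩
  · exact ⟨p, hl, Or.inr ⟨by omega, hc⟩⟩

/-- Greedy embedding: each ordinary letter costs one block, and the special letters together cost
at most one. -/
theorem Reaches.append (ht : 15 ≤ t) (r : List (Fin 3 ⊕ Fin t)) :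
    ∀ (l : List (Fin 3 ⊕ Fin t)) (R : Finset (Fin 3)) (lost : Fin 2) (a : ℕ),
      (l ++ r).Nodup → (∀ c, Sum.inl c ∈ r → c ∈ R) → a < offsetCap R lost →
      Reaches l (l.countP Sum.isRight + lost) a →
      ∃ i a, i ≤ (l ++ r).countP Sum.isRight + 1 ∧ a < 8 ∧ Reaches (l ++ r) i a := by
  induction r with
  | nil =>
    intro l R lost a _ _ ha h
    refine ⟨_, a, ?_, ha.trans_le (offsetCap_le _ _), by simpa using h⟩
    simp only [List.append_nil]
    omega
  | cons b r ih =>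
    intro l R lost a hn hR ha h
    have ha8 := ha.trans_le (offsetCap_le _ _)
    have hb : l ++ b :: r = (l ++ [b]) ++ r := by simp
    have hbl : b ∉ l := fun hbl =>
      (List.disjoint_of_nodup_append hn) hbl List.mem_cons_self
    have hbr : b ∉ r := (List.nodup_cons.1 hn.of_append_right).1
    rw [hb] at hn ⊢
    rcases b with c | c
    · have hR' : ∀ d, Sum.inl d ∈ r → d ∈ R.erase c := fun d hd =>
        Finset.mem_erase.2 ⟨fun hdc => hbr (hdc ▸ hd), hR d (List.mem_cons_of_mem _ hd)⟩
      have hcount : (l ++ [Sum.inl c]).countP Sum.isRight = l.countP Sum.isRight := by simp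
      let e : Fin 2 := Fin.ofNat 2 (l.countP Sum.isRight + lost)
      rcases exists_slot R lost ⟨a, ha8⟩ c e (hR c List.mem_cons_self) ha with
        ⟨s, hs, hc, hcap⟩ | ⟨h0, s, hc, hcap⟩
      · refine ih _ (R.erase c) lost (s + 1) hn hR' hcap ?_
        rw [hcount]
        refine h.inl ht (fun e' he' => ?_) hs
        rw [hc, Fin.ext (a := e') (b := e) (by simpa [e] using he')]
      · refine ih _ (R.erase c) 1 (s + 1) hn hR' hcap ?_
        rw [hcount]
        subst h0
        refine (h.next_block ht ha8).inl ht (fun e' he' => ?_) (Nat.zero_le _)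
        rw [hc, Fin.ext (a := e') (b := e + 1) (by
          simp only [e, Fin.val_add, Fin.val_ofNat, he']; simp)]
    · refine ih _ R lost a hn (fun d hd => hR d (List.mem_cons_of_mem _ hd)) ha ?_
      have hcount : (l ++ [Sum.inr c]).countP Sum.isRight + lost
          = l.countP Sum.isRight + lost + 1 := by simp; omega
      rw [hcount]
      exact h.inr hbl

theorem countP_isRight_le {t : ℕ} {l : List (Fin 3 ⊕ Fin t)} (hl : l.Nodup) :
    l.countP Sum.isRight ≤ t := by
  classical
  have h1 : (l.filter Sum.isRight).toFinset ⊆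
      (Finset.univ : Finset (Fin t)).map ⟨Sum.inr, Sum.inr_injective⟩ := by
    intro b hb
    rcases b with c | c <;> simp at hb ⊢
  have h2 := Finset.card_le_card h1
  rw [List.toFinset_card_of_nodup (hl.filter _), Finset.card_map, Finset.card_univ,
    Fintype.card_fin] at h2
  rwa [List.countP_eq_length_filter]

theorem sublist_word_of_nodup (ht : 15 ≤ t) {l : List (Fin 3 ⊕ Fin t)} (hl : l.Nodup) :
    l.Sublist (word t ((t + 1) * (t - 1) + 15)) := by
  obtain ⟨i, a, hi, ha, p, hp, hp'⟩ := Reaches.append ht l [] Finset.univ 0 0 (by simpa using hl)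
    (fun c _ => Finset.mem_univ c) (by decide) ⟨0, by simp, by simp⟩
  rw [List.nil_append] at hi hp
  have h1 : i * (t - 1) ≤ (t + 1) * (t - 1) :=
    Nat.mul_le_mul_right _ (hi.trans (Nat.add_le_add_right (countP_isRight_le hl) 1))
  exact hp.trans (word_sublist t (by omega))

/-! ### The length of the word -/

theorem length_word (p : ℕ) :
    (word t p).length = p + ∑ r ∈ Finset.range p, (inserted t r).length := by
  induction p with
  | zero => simp [word]
  | succ p ih =>
    rw [word_succ, List.length_append, ih, Finset.sum_range_succ, group, List.length_cons,
      List.length_map]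
    ring

/-- Two consecutive blocks hold seven special letters. -/
theorem two_mul_length_word (ht : 15 ≤ t) (i : ℕ) :
    2 * (word t (i * (t - 1))).length + i % 2 = 2 * (i * (t - 1)) + 7 * i := by
  have h : 2 * ∑ r ∈ Finset.range (i * (t - 1)), (inserted t r).length + i % 2 = 7 * i := by
    induction i with
    | zero => simp
    | succ i ih =>
      rw [add_mul, one_mul, Finset.sum_range_add, sum_length_inserted ht]
      omega
  rw [length_word]
  omega

theorem length_word_add_le (p k : ℕ) : (word t (p + k)).length ≤ (word t p).length + 8 * k := by
  induction k with
  | zero => simp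
  | succ k ih =>
    have h : (inserted t (p + k)).length ≤ 7 := by
      rw [inserted, List.length_map]
      exact (List.length_filter_le _ _).trans (by simp)
    rw [← add_assoc, word_succ, List.length_append, group, List.length_cons, List.length_map]
    omega

end Word

/-! ### Transfer to an arbitrary set of letters -/

/-- A word into which all repetition-free words over an alphabet embed gives, after renaming the
letters, a supersequence over any equinumerous set, padded to any greater length. -/
theorem exists_supersequence {α β : Type*} [Fintype β] {A : Finset α} (hA : A.Nonempty)
    (hcard : A.card = Fintype.card β) {w : List β} (hw : ∀ l : List β, l.Nodup → l.Sublist w)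
    {k : ℕ} (hk : w.length ≤ k) : ∃ σ : List α, IsSupersequenceOver A σ ∧ σ.length = k := by
  classical
  obtain ⟨a, ha⟩ := hA
  let e : A ≃ β := Fintype.equivOfCardEq (by simpa using hcard)
  refine ⟨w.map (fun b => (e.symm b : α)) ++ List.replicate (k - w.length) a,
    ⟨fun b hb => ?_, fun ρ ⟨hρ, hρA⟩ => ?_⟩, by simp; omega⟩
  · rcases List.mem_append.1 hb with hb | hb
    · obtain ⟨c, -, rfl⟩ := List.mem_map.1 hb
      exact (e.symm c).2
    · rwa [List.eq_of_mem_replicate hb]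
  · have h1 : (ρ.attach.map fun x : {x // x ∈ ρ} => e ⟨x, (hρA x).1 x.2⟩).Nodup :=
      (List.nodup_attach.2 hρ).map fun x y hxy => Subtype.ext (by simpa using hxy)
    have h2 := (hw _ h1).map fun b => (e.symm b : α)
    rw [List.map_map] at h2
    have h3 : ρ.attach.map ((fun b => (e.symm b : α)) ∘ fun x : {x // x ∈ ρ} => e ⟨x, (hρA x).1 x.2⟩) = ρ := by
      simp [Function.comp_def]
    rw [h3] at h2
    exact h2.trans (List.sublist_append_left _ _)

theorem theorem24 :
    ∀ ε : ℝ, 0 < ε → ∃ C : ℝ, ∃ M : ℕ, ∀ m : ℕ, M ≤ m →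
      ∀ (α : Type*) (A : Finset α), A.card = m →
        ∃ σ : List α, IsSupersequenceOver A σ ∧
          (σ.length : ℤ) = ⌈(m : ℝ) ^ 2 - (5 / 2 - ε) * (m : ℝ) + C⌉ := by
  intro ε hε
  -- the constant `121` covers the fifteen groups at the end, each of length at most eight; `18`
  -- makes every block longer than its range of slots
  refine ⟨121, 18, fun m hm α A hA => ?_⟩
  obtain ⟨t, rfl⟩ : ∃ t, m = t + 3 := ⟨m - 3, by omega⟩
  have ht : 15 ≤ t := by omega
  have : NeZero t := ⟨by omega⟩
  obtain ⟨q, rfl⟩ : ∃ q, t = q + 1 := ⟨t - 1, by omega⟩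
  set w := word (q + 1) ((q + 1 + 1) * (q + 1 - 1) + 15) with hw
  have hlen : (w.length : ℤ) ≤ ⌈((q + 1 + 3 : ℕ) : ℝ) ^ 2 - (5 / 2 - ε) * ((q + 1 + 3 : ℕ) : ℝ)
      + 121⌉ := by
    have h1 := two_mul_length_word ht (q + 1 + 1)
    have h2 := length_word_add_le (t := q + 1) ((q + 1 + 1) * (q + 1 - 1)) 15
    have h3 : 2 * w.length ≤ 2 * ((q + 1 + 1) * q) + 7 * (q + 1 + 1) + 240 := by
      simp only [add_tsub_cancel_right] at h1 h2 hw
      rw [hw]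
      omega
    have h4 : (2 : ℝ) * w.length ≤ 2 * ((q + 2) * q) + 7 * (q + 2) + 240 := by exact_mod_cast h3
    have h5 : (w.length : ℝ) ≤ ((q + 1 + 3 : ℕ) : ℝ) ^ 2 - (5 / 2 - ε) * ((q + 1 + 3 : ℕ) : ℝ)
        + 121 := by
      have h6 : 0 ≤ ε * ((q : ℝ) + 4) := by positivity
      push_cast
      nlinarith
    exact_mod_cast h5.trans (Int.le_ceil _)
  obtain ⟨k, hk⟩ := Int.eq_ofNat_of_zero_le ((Int.natCast_nonneg _).trans hlen)
  rw [hk] at hlen ⊢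
  obtain ⟨σ, hσ, hσk⟩ := exists_supersequence (β := Fin 3 ⊕ Fin (q + 1))
    (Finset.card_pos.1 (by omega : 0 < A.card)) (by simp; omega) (fun l hl => sublist_word_of_nodup ht hl) (Int.ofNat_le.1 hlen)
  exact ⟨σ, hσ, by rw [hσk]⟩
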